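/- A semi-Heyting algebra is an algebra $\langle A,\vee,\wedge,\to,0,1\rangle$ such that $\langle A,\vee,\wedge,0,1\rangle$ is a lattice with least element $0$ and greatest element $1$ and the identities $x\wedge(x\to y)\approx x\wedge y$, $x\wedge(y\to z)\approx x\wedge[(x\wedge y)\to(x\wedge z)]$ and $x\to x\approx 1$ hold. Put $x^*:=x\to 0$. Let $\mathbb{RUNO}1$ be the variety of all algebras $\langle A,\vee,\wedge,\to,{}',0,1\rangle$ whose reduct $\langle A,\vee,\wedge,\to,0,1\rangle$ is a semi-Heyting algebra and which satisfy $0'\approx 1$, $1'\approx 0$, $(x\wedge y)'\approx x'\vee y'$, $x''\approx x$ (De Morgan), $(0\to 1)'\approx 0\to 1$ (unorthodox), $x\wedge x'{}^{*}{}'\le y\vee y^*$ (regular) and $x\wedge x'{}^*\approx (x\wedge x'{}^*)'{}^*$ (level 1). For a class $\mathbb K$ of algebras and $\mathbf A,\mathbf B\in\mathbb K$, a homomorphism $h:\mathbf A\to\mathbf B$ is a $\mathbb K$-epimorphism if for every $\mathbf C\in\mathbb K$ and all homomorphisms $k,k':\mathbf B\to\mathbf C$, $k\circ h=k'\circ h$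 implies $k=k'$. Then every subvariety $\mathbb V$ of $\mathbb{RUNO}1$ (that is, every subclass of $\mathbb{RUNO}1$ that is closed under homomorphic images, subalgebras and direct products) has the property that epimorphisms are surjective (ES): for all $\mathbf A,\mathbf B\in\mathbb V$, every $\mathbb V$-epimorphism $h:\mathbf A\to\mathbf B$ is surjective. -/

import Mathlib

universe u

/-- A semi-Heyting algebra: a lattice with least element `⊥` (written 0) and greatest element `⊤`
(written 1), with an operation `→` (here `⇨`) subject to the three identities below. -/
class SemiHeytingAlgebra (A : Type u) extends Lattice A, BoundedOrder A, HImp A where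
  inf_himp_self' : ∀ x y : A, x ⊓ (x ⇨ y) = x ⊓ y
  inf_himp' : ∀ x y z : A, x ⊓ (y ⇨ z) = x ⊓ ((x ⊓ y) ⇨ (x ⊓ z))
  himp_self' : ∀ x : A, x ⇨ x = ⊤

/-- A dually hemimorphic semi-Heyting algebra: a semi-Heyting algebra with a unary
operation `dneg`, written `x ↦ x'` in the comments below. -/
class DHMSemiHeytingAlgebra (A : Type u) extends SemiHeytingAlgebra A where
  /-- The dual hemimorphism `x ↦ x'`. -/
  dneg : A → A
  dneg_bot : dneg ⊥ = ⊤
  dneg_top : dneg ⊤ = ⊥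
  dneg_inf : ∀ x y : A, dneg (x ⊓ y) = dneg x ⊔ dneg y

namespace DHMSemiHeytingAlgebra

/-- The pseudocomplement `x* = x → 0`. -/
def pcompl {A : Type u} [SemiHeytingAlgebra A] (x : A) : A := x ⇨ ⊥

/-- Dually quasi-De Morgan semi-Heyting algebras. -/
def IsDuallyQuasiDeMorgan (A : Type u) [DHMSemiHeytingAlgebra A] : Prop :=
  (∀ x y : A, dneg (dneg (x ⊔ y)) = dneg (dneg x) ⊔ dneg (dneg y)) ∧
    ∀ x : A, dneg (dneg x) ≤ x

/-- De Morgan semi-Heyting algebras. -/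
def IsDeMorgan (A : Type u) [DHMSemiHeytingAlgebra A] : Prop :=
  IsDuallyQuasiDeMorgan A ∧ ∀ x : A, dneg (dneg x) = x

/-- Unorthodox: `(0 → 1)' = 0 → 1`. -/
def IsUnorthodox (A : Type u) [DHMSemiHeytingAlgebra A] : Prop :=
  dneg ((⊥ : A) ⇨ ⊤) = (⊥ : A) ⇨ ⊤

/-- Regular: `x ∧ x'*' ≤ y ∨ y*`. -/
def IsRegular (A : Type u) [DHMSemiHeytingAlgebra A] : Prop :=
  ∀ x y : A, x ⊓ dneg (pcompl (dneg x)) ≤ y ⊔ pcompl y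

/-- Level 1: `x ∧ x'* = (x ∧ x'*)'*`. -/
def IsLevelOne (A : Type u) [DHMSemiHeytingAlgebra A] : Prop :=
  ∀ x : A, x ⊓ pcompl (dneg x) = pcompl (dneg (x ⊓ pcompl (dneg x)))

/-- A class of dually hemimorphic semi-Heyting algebras (with carriers in a fixed universe). -/
abbrev AlgClass : Type (u + 1) := ∀ (A : Type u) [DHMSemiHeytingAlgebra A], Prop

/-- The class of regular unorthodox De Morgan semi-Heyting algebras of level 1. -/
def RUNO1 : AlgClass.{u} := fun A _ =>
  IsDeMorgan A ∧ IsUnorthodox A ∧ IsRegular A ∧ IsLevelOne A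

/-- Homomorphisms: maps that preserve all the operations `∨, ∧, →, ', 0, 1`. -/
structure Hom (A B : Type u) [DHMSemiHeytingAlgebra A] [DHMSemiHeytingAlgebra B]
    extends BoundedLatticeHom A B where
  map_himp' : ∀ x y : A, toFun (x ⇨ y) = toFun x ⇨ toFun y
  map_dneg' : ∀ x : A, toFun (dneg x) = dneg (toFun x)

instance {A B : Type u} [DHMSemiHeytingAlgebra A] [DHMSemiHeytingAlgebra B] :
    CoeFun (Hom A B) (fun _ => A → B) where
  coe h := h.toFun

/-- Direct products, with the coordinatewise operations. -/
instance instPi {I : Type u} (A : I → Type u) [∀ i, DHMSemiHeytingAlgebra (A i)] :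
    DHMSemiHeytingAlgebra (∀ i, A i) where
  inf_himp_self' x y := funext fun i => SemiHeytingAlgebra.inf_himp_self' (x i) (y i)
  inf_himp' x y z := funext fun i => SemiHeytingAlgebra.inf_himp' (x i) (y i) (z i)
  himp_self' x := funext fun i => SemiHeytingAlgebra.himp_self' (x i)
  dneg x := fun i => dneg (x i)
  dneg_bot := funext fun _ => dneg_bot
  dneg_top := funext fun _ => dneg_top
  dneg_inf x y := funext fun i => dneg_inf (x i) (y i)

/-- A variety: a class of algebras closed under homomorphic images, subalgebras (isomorphic copies
included) and direct products of arbitrary, possibly empty, families. -/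
structure IsVariety (V : AlgClass.{u}) : Prop where
  homImage : ∀ (A B : Type u) [DHMSemiHeytingAlgebra A] [DHMSemiHeytingAlgebra B] (h : Hom A B),
    V A → Function.Surjective h → V B
  subalgebra : ∀ (A B : Type u) [DHMSemiHeytingAlgebra A] [DHMSemiHeytingAlgebra B] (h : Hom A B),
    V B → Function.Injective h → V A
  prod : ∀ (I : Type u) (A : I → Type u) [∀ i, DHMSemiHeytingAlgebra (A i)],
    (∀ i, V (A i)) → V (∀ i, A i)

/-- `V` is a subvariety of the class `W`. -/
def IsSubvariety (V W : AlgClass.{u}) : Prop :=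
  IsVariety V ∧ ∀ (A : Type u) [DHMSemiHeytingAlgebra A], V A → W A

/-- `h` is a `K`-epimorphism: it is right cancellable for homomorphisms into members of `K`. -/
def IsEpimorphism (K : AlgClass.{u}) {A B : Type u} [DHMSemiHeytingAlgebra A]
    [DHMSemiHeytingAlgebra B] (h : Hom A B) : Prop :=
  ∀ (C : Type u) [DHMSemiHeytingAlgebra C], K C → ∀ k k' : Hom B C,
    (∀ a : A, k (h a) = k' (h a)) → k = k'

/-- The property ES: between members of `K`, every `K`-epimorphism is surjective. -/
def HasES (K : AlgClass.{u}) : Prop :=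
  ∀ (A B : Type u) [DHMSemiHeytingAlgebra A] [DHMSemiHeytingAlgebra B], K A → K B →
    ∀ h : Hom A B, IsEpimorphism K h → Function.Surjective h

end DHMSemiHeytingAlgebra

/-! `B` behaves like a Boolean product over the prime spectrum of its central elements, those with
`e ⊓ dneg e = ⊥`. Equality below a central element outside a prime ideal is a congruence. Level 1
makes `x ⊓ pcompl (dneg x)` vanish off `⊤` in the quotient, and then every element there is the
value of a constant (`eq_constant_of_simple`). So elements of `B` are patched from constants along
central elements, and `h` is onto once its range contains the centre
(`surjective_of_central_subset_range`).

If a central `e` is missed, two prime ideals `P`, `Q` separate it yet have the same trace on the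
central elements of the range (`exists_prime_pair`). The projection `B → B/P` then has a rival:
replace `b` by some `h a` congruent to it modulo `Q`, and reduce modulo `P` (`transferHom`). The two
maps agree on the range and differ at `e`, while `B/P`, an image of `B`, lies in `V`; so `h` is no
epimorphism. -/

namespace DHMSemiHeytingAlgebra

/-! ### Residuation and distributivity in semi-Heyting algebras. -/

section SemiHeyting

variable {A : Type u} [SemiHeytingAlgebra A]

/-- Although `⇨` need not be residuated, `x ⇨ (x ⊓ y)` is the relative pseudocomplement. This gives
distributivity, hence the prime ideal theorem. -/
theorem le_himp_inf_iff (x y z : A) : z ≤ x ⇨ (x ⊓ y) ↔ x ⊓ z ≤ y := by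
  constructor
  · intro h
    calc x ⊓ z ≤ x ⊓ (x ⇨ (x ⊓ y)) := inf_le_inf_left x h
      _ = x ⊓ (x ⊓ y) := SemiHeytingAlgebra.inf_himp_self' _ _
      _ ≤ y := inf_le_right.trans inf_le_right
  · intro h
    have h1 : z ⊓ (x ⊓ y) = z ⊓ x := by
      rw [← inf_assoc]
      exact inf_eq_left.2 (by rwa [inf_comm])
    rw [← inf_eq_left, SemiHeytingAlgebra.inf_himp', h1, SemiHeytingAlgebra.himp_self', inf_top_eq]

instance instDistribLattice : DistribLattice A :=
  DistribLattice.ofInfSupLe fun x y z => by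
    rw [← le_himp_inf_iff]
    exact sup_le ((le_himp_inf_iff _ _ _).2 le_sup_left) ((le_himp_inf_iff _ _ _).2 le_sup_right)

theorem inf_pcompl (x : A) : x ⊓ pcompl x = ⊥ := by
  rw [pcompl, SemiHeytingAlgebra.inf_himp_self', inf_bot_eq]

theorem le_pcompl_iff {x y : A} : y ≤ pcompl x ↔ x ⊓ y = ⊥ := by
  have := le_himp_inf_iff x ⊥ y
  rwa [inf_bot_eq, le_bot_iff] at this

theorem pcompl_anti {x y : A} (h : x ≤ y) : pcompl y ≤ pcompl x := by
  rw [le_pcompl_iff, ← le_bot_iff, ← inf_pcompl y]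
  exact inf_le_inf_right _ h

theorem eq_of_isCompl_of_isCompl {a b c : A} (h1 : a ⊓ b = ⊥) (h2 : a ⊔ b = ⊤)
    (h3 : a ⊓ c = ⊥) (h4 : a ⊔ c = ⊤) : b = c :=
  eq_of_inf_eq_sup_eq (a := a) (by rw [inf_comm, h1, inf_comm, h3])
    (by rw [sup_comm, h2, sup_comm, h4])

/-- Symmetrized implication. -/
def biimp (x y : A) : A := (x ⇨ y) ⊓ (y ⇨ x)

theorem inf_biimp_le (x y : A) : x ⊓ biimp x y ≤ y :=
  calc x ⊓ biimp x y ≤ x ⊓ (x ⇨ y) := inf_le_inf_left x inf_le_left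
    _ = x ⊓ y := SemiHeytingAlgebra.inf_himp_self' _ _
    _ ≤ y := inf_le_right

theorem biimp_comm (x y : A) : biimp x y = biimp y x := inf_comm _ _

theorem inf_eq_inf_of_le_biimp {e x y : A} (h : e ≤ biimp x y) : x ⊓ e = y ⊓ e := by
  refine le_antisymm (le_inf ?_ inf_le_right) (le_inf ?_ inf_le_right)
  · exact (inf_le_inf_left x h).trans (inf_biimp_le x y)
  · rw [biimp_comm] at h
    exact (inf_le_inf_left y h).trans (inf_biimp_le y x)

theorem le_biimp {e x y : A} (h : x ⊓ e = y ⊓ e) : e ≤ biimp x y := by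
  have key : ∀ u v : A, u ⊓ e = v ⊓ e → e ≤ u ⇨ v := fun u v h => by
    rw [← inf_eq_left, SemiHeytingAlgebra.inf_himp', inf_comm e u, inf_comm e v, h,
      SemiHeytingAlgebra.himp_self', inf_top_eq]
  exact le_inf (key _ _ h) (key _ _ h.symm)

end SemiHeyting

section DeMorgan

variable {A : Type u} [DHMSemiHeytingAlgebra A]

theorem dneg_anti {x y : A} (h : x ≤ y) : dneg y ≤ dneg x := by
  rw [← sup_eq_left, ← dneg_inf, inf_eq_left.2 h]

end DeMorgan

/-! ### Simple algebras consist of constants. -/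

section Simple

variable {S : Type u} [DHMSemiHeytingAlgebra S]

theorem pcompl_dneg_of_simple (hdm : ∀ x : S, dneg (dneg x) = x)
    (hs : ∀ x : S, x = ⊤ ∨ x ⊓ pcompl (dneg x) = ⊥) {x : S} (h0 : x ≠ ⊥) (h1 : x ≠ ⊤) :
    pcompl (dneg x) = pcompl x := by
  apply le_antisymm
  · exact le_pcompl_iff.2 ((hs x).resolve_left h1)
  · have h2 : dneg x ≠ ⊤ := fun h => h0 (by rw [← hdm x, h, dneg_top])
    have := (hs _).resolve_left h2
    rw [hdm] at this
    exact le_pcompl_iff.2 this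

/-- With `p = pcompl x`, regularity at `(x, p)` and `(dneg x, p)` makes `x` and `dneg x` both
complements of `dneg p`, hence equal; then `p` and `dneg p` are both complements of `x`. -/
theorem dneg_eq_self_of_pcompl_ne_bot (hdm : ∀ x : S, dneg (dneg x) = x) (hr : IsRegular S)
    (hs : ∀ x : S, x = ⊤ ∨ x ⊓ pcompl (dneg x) = ⊥) {x : S} (h1 : x ≠ ⊤)
    (hx : x ≠ ⊥) (hp : pcompl x ≠ ⊥) :
    dneg x = x ∧ dneg (pcompl x) = pcompl x ∧ x ⊔ pcompl x = ⊤ := by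
  set p := pcompl x with hpdef
  have hxp : pcompl (dneg x) = p := pcompl_dneg_of_simple hdm hs hx h1
  have a1 : x ⊓ p = ⊥ := inf_pcompl x
  have a2 : dneg x ⊓ p = ⊥ := by rw [← hxp]; exact inf_pcompl _
  have b1 : dneg x ⊔ dneg p = ⊤ := by rw [← dneg_inf, a1, dneg_bot]
  have b2 : x ⊔ dneg p = ⊤ := by
    have := dneg_inf (dneg x) p
    rwa [a2, dneg_bot, hdm, eq_comm] at this
  have hp1 : p ≠ ⊤ := fun h => hx (by rw [← inf_top_eq x, ← h, a1])
  have c1 : x ⊓ dneg p ≤ p ⊔ pcompl p := by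
    have := hr x p
    rwa [hxp] at this
  have c2 : dneg x ⊓ dneg p ≤ p ⊔ pcompl p := by
    have := hr (dneg x) p
    rwa [hdm] at this
  have d : dneg p ⊓ pcompl p = ⊥ := by
    rw [← pcompl_dneg_of_simple hdm hs hp hp1]; exact inf_pcompl _
  have key : ∀ z : S, z ⊓ p = ⊥ → z ⊓ dneg p ≤ p ⊔ pcompl p → z ⊓ dneg p = ⊥ := by
    intro z hz h
    rw [← le_bot_iff]
    calc z ⊓ dneg p ≤ (z ⊓ dneg p) ⊓ (p ⊔ pcompl p) := le_inf le_rfl h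
      _ = ((z ⊓ p) ⊓ dneg p) ⊔ (z ⊓ (dneg p ⊓ pcompl p)) := by
        rw [inf_sup_left, inf_right_comm, inf_assoc z (dneg p)]
      _ ≤ ⊥ := by rw [hz, d]; simp
  have e1 := key x a1 c1
  have e2 := key (dneg x) a2 c2
  have f : dneg x = x := eq_of_isCompl_of_isCompl (a := dneg p) (by rwa [inf_comm])
    (by rwa [sup_comm]) (by rwa [inf_comm]) (by rwa [sup_comm])
  have g : x ⊔ p = ⊤ := by
    have := dneg_inf x (dneg p)
    rwa [e1, dneg_bot, hdm, f, eq_comm] at this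
  exact ⟨f, eq_of_isCompl_of_isCompl e1 b2 a1 g, g⟩

/-- The elements other than `⊥`, `⊤` are either all dense, and regularity identifies them with `⊥ ⇨
⊤`, or all self-dual complemented atoms, of which there are only `⊥ ⇨ ⊤` and its complement. -/
theorem eq_constant_of_simple (hdm : ∀ x : S, dneg (dneg x) = x) (hu : IsUnorthodox S)
    (hr : IsRegular S) (hs : ∀ x : S, x = ⊤ ∨ x ⊓ pcompl (dneg x) = ⊥) (x : S) :
    x = ⊥ ∨ x = ⊤ ∨ x = (⊥ ⇨ ⊤) ∨ x = pcompl (⊥ ⇨ ⊤) := by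
  rw [IsUnorthodox] at hu
  set m : S := ⊥ ⇨ ⊤
  by_cases hx0 : x = ⊥
  · exact Or.inl hx0
  by_cases hx1 : x = ⊤
  · exact Or.inr (Or.inl hx1)
  refine Or.inr (Or.inr ?_)
  have hbt : (⊥ : S) ≠ ⊤ := fun h => hx0 (le_bot_iff.1 (h ▸ le_top))
  -- A fixed point of `dneg` is neither bound, since `dneg` swaps them.
  have hm0 : m ≠ ⊥ := fun h => hbt (by rw [← h, ← hu, h, dneg_bot])
  have hm1 : m ≠ ⊤ := fun h => hbt (by rw [← h, ← hu, h, dneg_top])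
  have hself := fun y : S => dneg_eq_self_of_pcompl_ne_bot hdm hr hs (x := y)
  have dense : ∀ y z : S, y ≠ ⊥ → y ≠ ⊤ → pcompl y = ⊥ → y ≤ z ⊔ pcompl z := by
    intro y z h0 h1 hy
    have := hr y z
    rwa [pcompl_dneg_of_simple hdm hs h0 h1, hy, dneg_bot, inf_top_eq] at this
  -- Both `z` and `y ⊓ z` are self-dual, so `y ⊓ z = dneg y ⊔ z ≥ z`: such a `z` is an atom.
  have overlap : ∀ y z : S, z ≠ ⊤ → z ≠ ⊥ → pcompl z ≠ ⊥ → y ⊓ z ≠ ⊥ → z ≤ y := by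
    intro y z hz1 hz0 hpz hyz
    have hne : y ⊓ z ≠ ⊤ := fun h => hz1 (top_le_iff.1 (h ▸ inf_le_right))
    have h1 : pcompl (y ⊓ z) ≠ ⊥ := fun h =>
      hpz (le_bot_iff.1 (h ▸ pcompl_anti inf_le_right))
    have h2 := (hself _ hne hyz h1).1
    rw [dneg_inf, (hself z hz1 hz0 hpz).1] at h2
    exact le_sup_right.trans (h2.le.trans inf_le_left)
  have pcompl_ne : ∀ y : S, y ≠ ⊥ → pcompl y ≠ ⊤ := fun y h0 h =>
    h0 (by rw [← inf_top_eq y, ← h, inf_pcompl])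
  have pcompl_pcompl_ne : ∀ y : S, y ≠ ⊥ → pcompl (pcompl y) ≠ ⊥ := fun y h0 h =>
    h0 (le_bot_iff.1 (h ▸ le_pcompl_iff.2 (by rw [inf_comm, inf_pcompl])))
  -- A dense `z` would meet both `y` and `pcompl y`, hence lie above their join `⊤`.
  have pcompl_ne_bot_of_exists : ∀ y z : S, y ≠ ⊥ → y ≠ ⊤ → pcompl y ≠ ⊥ → z ≠ ⊥ → z ≠ ⊤ →
      pcompl z ≠ ⊥ := by
    intro y z y0 y1 hy z0 z1 hz
    have meets : ∀ w : S, w ≠ ⊥ → z ⊓ w ≠ ⊥ := fun w hw h =>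
      hw (le_bot_iff.1 (hz ▸ le_pcompl_iff.2 h))
    have h1 := overlap z y y1 y0 hy (meets y y0)
    have h2 := overlap z (pcompl y) (pcompl_ne y y0) hy (pcompl_pcompl_ne y y0) (meets _ hy)
    exact z1 (top_le_iff.1 ((hself y y1 y0 hy).2.2 ▸ sup_le h1 h2))
  by_cases hm : pcompl m = ⊥
  · left
    have hx : pcompl x = ⊥ := by
      by_contra hx
      exact pcompl_ne_bot_of_exists x m hx0 hx1 hx hm0 hm1 hm
    apply le_antisymm
    · simpa [hm] using dense x m hx0 hx1 hx
    · simpa [hx] using dense m x hm0 hm1 hm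
  · have hx := pcompl_ne_bot_of_exists m x hm0 hm1 hm hx0 hx1
    have same : ∀ y : S, y ≠ ⊥ → y ≠ ⊤ → pcompl y ≠ ⊥ → x ⊓ y ≠ ⊥ → x = y :=
      fun y y0 y1 hy h => le_antisymm (overlap y x hx1 hx0 hx (by rwa [inf_comm]))
        (overlap x y y1 y0 hy h)
    by_cases h1 : x ⊓ m = ⊥
    · by_cases h2 : x ⊓ pcompl m = ⊥
      · exact absurd (by rw [← inf_top_eq x, ← (hself m hm1 hm0 hm).2.2, inf_sup_left, h1, h2,
          sup_bot_eq]) hx0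
      · exact Or.inr (same _ hm (pcompl_ne m hm0) (pcompl_pcompl_ne m hm0) h2)
    · exact Or.inl (same m hm0 hm1 hm h1)

end Simple

/-! ### Quotients by congruences. -/

section Quotient

/-- Congruences of dually hemimorphic semi-Heyting algebras. -/
structure Congruence (B : Type u) [DHMSemiHeytingAlgebra B] extends Setoid B where
  sup' : ∀ {x y z w : B}, r x y → r z w → r (x ⊔ z) (y ⊔ w)
  inf' : ∀ {x y z w : B}, r x y → r z w → r (x ⊓ z) (y ⊓ w)
  himp' : ∀ {x y z w : B}, r x y → r z w → r (x ⇨ z) (y ⇨ w)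
  dneg' : ∀ {x y : B}, r x y → r (dneg x) (dneg y)

variable {B : Type u} [DHMSemiHeytingAlgebra B]

/-- The quotient of an algebra by a congruence. -/
def Congruence.Quotient (c : Congruence B) : Type u := _root_.Quotient c.toSetoid

/-- The class of an element. -/
def Congruence.toQuot (c : Congruence B) (x : B) : c.Quotient := Quotient.mk c.toSetoid x

theorem Congruence.toQuot_surjective (c : Congruence B) : Function.Surjective c.toQuot :=
  Quotient.mk_surjective

theorem Congruence.toQuot_eq_iff (c : Congruence B) {x y : B} : c.toQuot x = c.toQuot y ↔ c.r x y :=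
  Quotient.eq (r := c.toSetoid)

instance (c : Congruence B) : Max c.Quotient :=
  ⟨Quotient.map₂ (· ⊔ ·) fun _ _ h _ _ h' => c.sup' h h'⟩

instance (c : Congruence B) : Min c.Quotient :=
  ⟨Quotient.map₂ (· ⊓ ·) fun _ _ h _ _ h' => c.inf' h h'⟩

instance (c : Congruence B) : HImp c.Quotient :=
  ⟨Quotient.map₂ (· ⇨ ·) fun _ _ h _ _ h' => c.himp' h h'⟩

instance (c : Congruence B) : Lattice c.Quotient :=
  Lattice.mk'
    (by rintro ⟨x⟩ ⟨y⟩; exact congrArg c.toQuot (sup_comm x y))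
    (by rintro ⟨x⟩ ⟨y⟩ ⟨z⟩; exact congrArg c.toQuot (sup_assoc x y z))
    (by rintro ⟨x⟩ ⟨y⟩; exact congrArg c.toQuot (inf_comm x y))
    (by rintro ⟨x⟩ ⟨y⟩ ⟨z⟩; exact congrArg c.toQuot (inf_assoc x y z))
    (by rintro ⟨x⟩ ⟨y⟩; exact congrArg c.toQuot (sup_inf_self (a := x) (b := y)))
    (by rintro ⟨x⟩ ⟨y⟩; exact congrArg c.toQuot (inf_sup_self (a := x) (b := y)))

instance (c : Congruence B) : DHMSemiHeytingAlgebra c.Quotient where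
  top := c.toQuot ⊤
  bot := c.toQuot ⊥
  le_top := by rintro ⟨x⟩; exact sup_eq_right.1 (congrArg c.toQuot (sup_top_eq x))
  bot_le := by rintro ⟨x⟩; exact sup_eq_right.1 (congrArg c.toQuot (bot_sup_eq x))
  inf_himp_self' := by
    rintro ⟨x⟩ ⟨y⟩; exact congrArg c.toQuot (SemiHeytingAlgebra.inf_himp_self' x y)
  inf_himp' := by
    rintro ⟨x⟩ ⟨y⟩ ⟨z⟩; exact congrArg c.toQuot (SemiHeytingAlgebra.inf_himp' x y z)
  himp_self' := by rintro ⟨x⟩; exact congrArg c.toQuot (SemiHeytingAlgebra.himp_self' x)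
  dneg := Quotient.map dneg fun _ _ h => c.dneg' h
  dneg_bot := congrArg c.toQuot dneg_bot
  dneg_top := congrArg c.toQuot dneg_top
  dneg_inf := by rintro ⟨x⟩ ⟨y⟩; exact congrArg c.toQuot (dneg_inf x y)

/-- The quotient map as a homomorphism. -/
def Congruence.mkHom (c : Congruence B) : Hom B c.Quotient where
  toFun := c.toQuot
  map_sup' _ _ := rfl
  map_inf' _ _ := rfl
  map_top' := rfl
  map_bot' := rfl
  map_himp' _ _ := rfl
  map_dneg' _ := rfl

end Quotient

/-! ### Central elements and the congruences of prime ideals. -/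

section Central

variable {B : Type u} [DHMSemiHeytingAlgebra B]

/-- An element is central if it is disjoint from its dual. -/
def IsCentral (e : B) : Prop := e ⊓ dneg e = ⊥

/-- The term `x ∧ x'*`. -/
def delta (x : B) : B := x ⊓ pcompl (dneg x)

theorem delta_le (x : B) : delta x ≤ x := inf_le_left

theorem delta_mono {x y : B} (h : x ≤ y) : delta x ≤ delta y :=
  inf_le_inf h (pcompl_anti (dneg_anti h))

theorem IsCentral.delta_eq {e : B} (he : IsCentral e) : delta e = e :=
  inf_eq_left.2 (le_pcompl_iff.2 (by rwa [inf_comm]))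

theorem isCentral_delta (hl : IsLevelOne B) (x : B) : IsCentral (delta x) := by
  have h : delta x ≤ pcompl (dneg (delta x)) := (hl x).le
  rw [le_pcompl_iff, inf_comm] at h
  exact h

theorem isCentral_top : IsCentral (⊤ : B) := by rw [IsCentral, dneg_top, inf_bot_eq]

theorem IsCentral.inf {e f : B} (he : IsCentral e) (hf : IsCentral f) : IsCentral (e ⊓ f) := by
  rw [IsCentral] at *
  rw [dneg_inf, inf_sup_left, inf_right_comm, he, inf_assoc, hf]
  simp

theorem IsCentral.dneg (hdm : ∀ x : B, dneg (dneg x) = x) {e : B} (he : IsCentral e) :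
    IsCentral (dneg e) := by
  rwa [IsCentral, hdm, inf_comm]

theorem IsCentral.sup_dneg (hdm : ∀ x : B, DHMSemiHeytingAlgebra.dneg
    (DHMSemiHeytingAlgebra.dneg x) = x) {e : B} (he : IsCentral e) :
    e ⊔ DHMSemiHeytingAlgebra.dneg e = ⊤ := by
  have := dneg_inf e (DHMSemiHeytingAlgebra.dneg e)
  rwa [he, dneg_bot, hdm, sup_comm, eq_comm] at this

theorem sup_inf_congr {x y z w e : B} (h : x ⊓ e = y ⊓ e) (h' : z ⊓ e = w ⊓ e) :
    (x ⊔ z) ⊓ e = (y ⊔ w) ⊓ e := by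
  rw [inf_sup_right, inf_sup_right, h, h']

theorem inf_inf_congr {x y z w e : B} (h : x ⊓ e = y ⊓ e) (h' : z ⊓ e = w ⊓ e) :
    (x ⊓ z) ⊓ e = (y ⊓ w) ⊓ e := by
  rw [inf_inf_distrib_right, inf_inf_distrib_right y, h, h']

theorem himp_inf_congr {x y z w e : B} (h : x ⊓ e = y ⊓ e) (h' : z ⊓ e = w ⊓ e) :
    (x ⇨ z) ⊓ e = (y ⇨ w) ⊓ e := by
  rw [inf_comm, inf_comm _ e, SemiHeytingAlgebra.inf_himp', SemiHeytingAlgebra.inf_himp' e y w,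
    inf_comm e x, inf_comm e y, inf_comm e z, inf_comm e w, h, h']

/-- `dneg (z ⊓ e)` exceeds `dneg z` only by `dneg e`, which is disjoint from `e`. -/
theorem IsCentral.dneg_inf_congr {x y e : B} (he : IsCentral e) (h : x ⊓ e = y ⊓ e) :
    DHMSemiHeytingAlgebra.dneg x ⊓ e = DHMSemiHeytingAlgebra.dneg y ⊓ e := by
  have key : ∀ z : B, DHMSemiHeytingAlgebra.dneg z ⊓ e =
      DHMSemiHeytingAlgebra.dneg (z ⊓ e) ⊓ e := fun z => by
    rw [dneg_inf, inf_sup_right, inf_comm (DHMSemiHeytingAlgebra.dneg e), he, sup_bot_eq]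
  rw [key, key y, h]

variable {P : Order.Ideal B}

theorem IsCentral.dneg_notMem (hdm : ∀ x : B, DHMSemiHeytingAlgebra.dneg
    (DHMSemiHeytingAlgebra.dneg x) = x) (hP : P.IsPrime) {e : B} (he : IsCentral e)
    (h : e ∈ P) : DHMSemiHeytingAlgebra.dneg e ∉ P := fun h' =>
  hP.toIsProper.top_notMem (he.sup_dneg hdm ▸ P.sup_mem h h')

/-- The congruence of a prime ideal: equality below a central element outside the ideal. -/
def primeCongruence (P : Order.Ideal B) (hP : P.IsPrime) : Congruence B where
  r x y := ∃ e, IsCentral e ∧ e ∉ P ∧ x ⊓ e = y ⊓ e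
  iseqv :=
    { refl := fun x => ⟨⊤, isCentral_top, hP.toIsProper.top_notMem, rfl⟩
      symm := fun ⟨e, h1, h2, h3⟩ => ⟨e, h1, h2, h3.symm⟩
      trans := fun ⟨e, h1, h2, h3⟩ ⟨f, g1, g2, g3⟩ => ⟨e ⊓ f, h1.inf g1,
        fun h => (hP.mem_or_mem h).elim h2 g2, by
          rw [← inf_assoc, h3, inf_right_comm, g3, inf_right_comm, inf_assoc]⟩ }
  sup' := fun ⟨e, h1, h2, h3⟩ ⟨f, g1, g2, g3⟩ => ⟨e ⊓ f, h1.inf g1,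
    fun h => (hP.mem_or_mem h).elim h2 g2, sup_inf_congr (by rw [← inf_assoc, h3, inf_assoc])
      (by rw [inf_comm e f, ← inf_assoc, g3, inf_assoc])⟩
  inf' := fun ⟨e, h1, h2, h3⟩ ⟨f, g1, g2, g3⟩ => ⟨e ⊓ f, h1.inf g1,
    fun h => (hP.mem_or_mem h).elim h2 g2, inf_inf_congr (by rw [← inf_assoc, h3, inf_assoc])
      (by rw [inf_comm e f, ← inf_assoc, g3, inf_assoc])⟩
  himp' := fun ⟨e, h1, h2, h3⟩ ⟨f, g1, g2, g3⟩ => ⟨e ⊓ f, h1.inf g1,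
    fun h => (hP.mem_or_mem h).elim h2 g2, himp_inf_congr (by rw [← inf_assoc, h3, inf_assoc])
      (by rw [inf_comm e f, ← inf_assoc, g3, inf_assoc])⟩
  dneg' := fun ⟨e, h1, h2, h3⟩ => ⟨e, h1, h2, h1.dneg_inf_congr h3⟩

/-- The degree to which two elements agree: the largest central element below which they are
equal. -/
def agree (x y : B) : B := delta (biimp x y)

theorem inf_agree (x y : B) : x ⊓ agree x y = y ⊓ agree x y :=
  inf_eq_inf_of_le_biimp (delta_le _)

theorem IsCentral.le_agree {e x y : B} (he : IsCentral e) (h : x ⊓ e = y ⊓ e) : e ≤ agree x y :=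
  he.delta_eq ▸ delta_mono (le_biimp h)

theorem primeCongruence_iff (hl : IsLevelOne B) (hP : P.IsPrime) {x y : B} :
    (primeCongruence P hP).r x y ↔ agree x y ∉ P :=
  ⟨fun ⟨_, he, h, hxy⟩ h' => h (P.lower (he.le_agree hxy) h'),
    fun h => ⟨_, isCentral_delta hl _, h, inf_agree x y⟩⟩

/-- If `delta x ∈ P`, the central element `dneg (delta x)` lies outside `P` and collapses `delta x`
to `⊥`; otherwise `delta x` itself identifies `x` with `⊤`. -/
theorem primeCongruence_simple (hdm : ∀ x : B, dneg (dneg x) = x) (hl : IsLevelOne B)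
    (hP : P.IsPrime) (x : (primeCongruence P hP).Quotient) :
    x = ⊤ ∨ x ⊓ pcompl (dneg x) = ⊥ := by
  obtain ⟨x, rfl⟩ := Congruence.toQuot_surjective _ x
  have hc := isCentral_delta hl x
  by_cases h : delta x ∈ P
  · right
    refine (Congruence.toQuot_eq_iff _ (x := delta x) (y := ⊥)).2
      ⟨dneg (delta x), hc.dneg hdm, hc.dneg_notMem hdm hP h, ?_⟩
    rw [hc, bot_inf_eq]
  · left
    refine (Congruence.toQuot_eq_iff _ (y := ⊤)).2 ⟨delta x, hc, h, ?_⟩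
    rw [top_inf_eq, inf_eq_right]
    exact delta_le x

/-- The algebra is covered by the regions where `b` equals one of the four constants. -/
theorem sup_agree_eq_top (hB : RUNO1 B)
    (hQ : ∀ (P : Order.Ideal B) (hP : P.IsPrime), RUNO1 (primeCongruence P hP).Quotient)
    (b : B) :
    agree b ⊥ ⊔ (agree b ⊤ ⊔ (agree b (⊥ ⇨ ⊤) ⊔ agree b (pcompl (⊥ ⇨ ⊤)))) = ⊤ := by
  obtain ⟨⟨-, hdm⟩, -, -, hl⟩ := hB
  by_contra hne
  set s := agree b ⊥ ⊔ (agree b ⊤ ⊔ (agree b (⊥ ⇨ ⊤) ⊔ agree b (pcompl (⊥ ⇨ ⊤))))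
  -- If `s ≠ ⊤`, some prime ideal contains `s`; modulo it `b` would differ from all four constants.
  have hd : Disjoint (Order.PFilter.principal (⊤ : B) : Set B)
      (Order.Ideal.principal s : Set B) := by
    rw [Set.disjoint_left]
    intro x h1 h2
    exact hne (top_le_iff.1 ((show ⊤ ≤ x from h1).trans (show x ≤ s from h2)))
  obtain ⟨P, hP, hsP, -⟩ := DistribLattice.prime_ideal_of_disjoint_filter_ideal hd
  have hs : s ∈ P := hsP (le_refl s)
  simp only [s, Order.Ideal.sup_mem_iff] at hs
  obtain ⟨h0, h1, hm, hm'⟩ := hs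
  obtain ⟨⟨-, hdm'⟩, hu, hr, -⟩ := hQ P hP
  have ne_of_agree_mem : ∀ c : B, agree b c ∈ P →
      (primeCongruence P hP).toQuot b ≠ (primeCongruence P hP).toQuot c :=
    fun c hc h => (primeCongruence_iff hl hP).1 ((Congruence.toQuot_eq_iff _).1 h) hc
  rcases eq_constant_of_simple hdm' hu hr (primeCongruence_simple hdm hl hP)
    ((primeCongruence P hP).toQuot b) with h | h | h | h
  · exact ne_of_agree_mem _ h0 h
  · exact ne_of_agree_mem _ h1 h
  · exact ne_of_agree_mem _ hm h
  · exact ne_of_agree_mem _ hm' h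

end Central

/-! ### Non-surjective homomorphisms are not epimorphisms. -/

section Epimorphism

variable {A B : Type u} [DHMSemiHeytingAlgebra A] [DHMSemiHeytingAlgebra B]

namespace Hom

theorem map_sup (h : Hom A B) (x y : A) : h (x ⊔ y) = h x ⊔ h y := h.map_sup' x y

theorem map_inf (h : Hom A B) (x y : A) : h (x ⊓ y) = h x ⊓ h y := h.map_inf' x y

theorem map_himp (h : Hom A B) (x y : A) : h (x ⇨ y) = h x ⇨ h y := h.map_himp' x y

theorem map_dneg (h : Hom A B) (x : A) : h (dneg x) = dneg (h x) := h.map_dneg' x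

theorem map_top (h : Hom A B) : h (⊤ : A) = ⊤ := h.map_top'

theorem map_bot (h : Hom A B) : h (⊥ : A) = ⊥ := h.map_bot'

theorem map_pcompl (h : Hom A B) (x : A) : h (pcompl x) = pcompl (h x) := by
  rw [pcompl, map_himp, map_bot, pcompl]

/-- Agreement of two elements of the range is thus itself in the range, so the trace of a prime
ideal on central range elements decides their congruence. -/
theorem map_agree (h : Hom A B) (x y : A) : h (agree x y) = agree (h x) (h y) := by
  simp only [agree, delta, biimp, map_inf, map_himp, map_pcompl, map_dneg]

end Hom

/-- A prime quotient consists of the values of the constants. -/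
theorem exists_primeCongruence_constant (hB : RUNO1 B)
    (hQ : ∀ (P : Order.Ideal B) (hP : P.IsPrime), RUNO1 (primeCongruence P hP).Quotient)
    (h : Hom A B) (P : Order.Ideal B) (hP : P.IsPrime) (b : B) :
    ∃ a, (primeCongruence P hP).r b (h a) := by
  obtain ⟨⟨-, hdm⟩, -, -, hl⟩ := hB
  obtain ⟨⟨-, hdm'⟩, hu, hr, -⟩ := hQ P hP
  rcases eq_constant_of_simple hdm' hu hr (primeCongruence_simple hdm hl hP)
    ((primeCongruence P hP).toQuot b) with e | e | e | e
  · exact ⟨⊥, (Congruence.toQuot_eq_iff _).1 (h.map_bot ▸ e)⟩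
  · exact ⟨⊤, (Congruence.toQuot_eq_iff _).1 (h.map_top ▸ e)⟩
  · refine ⟨⊥ ⇨ ⊤, (Congruence.toQuot_eq_iff _).1 ?_⟩
    rw [h.map_himp, h.map_bot, h.map_top]
    exact e
  · refine ⟨pcompl (⊥ ⇨ ⊤), (Congruence.toQuot_eq_iff _).1 ?_⟩
    rw [h.map_pcompl, h.map_himp, h.map_bot, h.map_top]
    exact e

/-- If all central elements of the codomain are attained, the homomorphism is onto. -/
theorem surjective_of_central_subset_range (hB : RUNO1 B)
    (hQ : ∀ (P : Order.Ideal B) (hP : P.IsPrime), RUNO1 (primeCongruence P hP).Quotient)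
    (h : Hom A B) (hc : ∀ e : B, IsCentral e → ∃ a, h a = e) : Function.Surjective h := by
  intro b
  -- On `agree b (h c)`, `b` may be replaced by `h c`; what remains is a range element cut by a
  -- central one.
  have part : ∀ c : A, ∃ a, h a = b ⊓ agree b (h c) := fun c => by
    obtain ⟨a, ha⟩ := hc _ (isCentral_delta hB.2.2.2 (biimp b (h c)))
    exact ⟨c ⊓ a, by rw [inf_agree, h.map_inf, ha, agree]⟩
  obtain ⟨a0, h0⟩ := part ⊥
  obtain ⟨a1, h1⟩ := part ⊤
  obtain ⟨a2, h2⟩ := part (⊥ ⇨ ⊤)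
  obtain ⟨a3, h3⟩ := part (pcompl (⊥ ⇨ ⊤))
  refine ⟨a0 ⊔ (a1 ⊔ (a2 ⊔ a3)), ?_⟩
  simp only [h.map_pcompl, h.map_himp, h.map_bot, h.map_top] at h0 h1 h2 h3
  rw [h.map_sup, h.map_sup, h.map_sup, h0, h1, h2, h3, ← inf_sup_left, ← inf_sup_left,
    ← inf_sup_left, sup_agree_eq_top hB hQ, inf_top_eq]

/-- A central element outside the range is separated from it by two prime ideals with the same
trace on the central part of the range. -/
theorem exists_prime_pair (hdm : ∀ x : B, dneg (dneg x) = x) (h : Hom A B) {e : B}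
    (he : ¬ ∃ a, h a = e) :
    ∃ P Q : Order.Ideal B, P.IsPrime ∧ Q.IsPrime ∧ e ∉ P ∧ e ∈ Q ∧
      ∀ a, IsCentral (h a) → (h a ∈ P ↔ h a ∈ Q) := by
  have bot_c : IsCentral (⊥ : B) := bot_inf_eq _
  have sup_c : ∀ x y : B, IsCentral x → IsCentral y → IsCentral (x ⊔ y) := fun x y hx hy => by
    have := ((hx.dneg hdm).inf (hy.dneg hdm)).dneg hdm
    rwa [dneg_inf, hdm, hdm] at this
  -- Generated by the central range elements below `e`; were `e` in it, `e` would be in the range.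
  let I : Order.Ideal B :=
    { carrier := {x | ∃ a, IsCentral (h a) ∧ x ≤ h a ∧ h a ≤ e}
      lower' := fun x y hyx ⟨a, h1, h2, h3⟩ => ⟨a, h1, hyx.trans h2, h3⟩
      nonempty' := ⟨⊥, ⊥, by rw [h.map_bot]; exact bot_c, bot_le, by rw [h.map_bot]; exact bot_le⟩
      directed' := fun x ⟨a, h1, h2, h3⟩ y ⟨b, g1, g2, g3⟩ => ⟨x ⊔ y,
        ⟨a ⊔ b, by rw [h.map_sup]; exact sup_c _ _ h1 g1, by rw [h.map_sup]; exact sup_le_sup h2 g2,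
          by rw [h.map_sup]; exact sup_le h3 g3⟩, le_sup_left, le_sup_right⟩ }
  have hd : Disjoint (Order.PFilter.principal e : Set B) (I : Set B) := by
    rw [Set.disjoint_left]
    rintro x h1 ⟨a, -, h2, h3⟩
    exact he ⟨a, le_antisymm h3 ((show e ≤ x from h1).trans h2)⟩
  obtain ⟨P, hP, hIP, hFP⟩ := DistribLattice.prime_ideal_of_disjoint_filter_ideal hd
  have heP : e ∉ P := fun h' => Set.disjoint_left.1 hFP (le_refl e) h'
  -- `Q` must contain `e` and the central range elements in `P`, which generate `J`, and avoid those
  -- outside `P`, which generate `F`.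
  let J : Order.Ideal B :=
    { carrier := {x | ∃ a, IsCentral (h a) ∧ h a ∈ P ∧ x ≤ e ⊔ h a}
      lower' := fun x y hyx ⟨a, h1, h2, h3⟩ => ⟨a, h1, h2, hyx.trans h3⟩
      nonempty' := ⟨⊥, ⊥, by rw [h.map_bot]; exact bot_c, by rw [h.map_bot]; exact P.bot_mem, bot_le⟩
      directed' := fun x ⟨a, h1, h2, h3⟩ y ⟨b, g1, g2, g3⟩ => ⟨x ⊔ y,
        ⟨a ⊔ b, by rw [h.map_sup]; exact sup_c _ _ h1 g1, by rw [h.map_sup]; exact P.sup_mem h2 g2,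
          by rw [h.map_sup, sup_sup_distrib_left]; exact sup_le_sup h3 g3⟩,
        le_sup_left, le_sup_right⟩ }
  let F : Order.PFilter B := Order.IsPFilter.toPFilter
    (F := {x | ∃ a, IsCentral (h a) ∧ h a ∉ P ∧ h a ≤ x}) (.of_def
      ⟨⊤, ⊤, by rw [h.map_top]; exact isCentral_top,
        by rw [h.map_top]; exact hP.toIsProper.top_notMem, le_top⟩
      (fun x ⟨a, h1, h2, h3⟩ y ⟨b, g1, g2, g3⟩ => ⟨x ⊓ y,
        ⟨a ⊓ b, by rw [h.map_inf]; exact h1.inf g1,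
          by rw [h.map_inf]; exact fun h' => (hP.mem_or_mem h').elim h2 g2,
          by rw [h.map_inf]; exact inf_le_inf h3 g3⟩, inf_le_left, inf_le_right⟩)
      (fun {x y} hxy ⟨a, h1, h2, h3⟩ => ⟨a, h1, h2, h3.trans hxy⟩))
  have hd' : Disjoint (F : Set B) (J : Set B) := by
    rw [Set.disjoint_left]
    rintro x ⟨a, h1, h2, h3⟩ ⟨c, g1, g2, g3⟩
    apply h2
    -- From `h a ≤ e ⊔ h c`, cutting by `dneg (h c)` gives a central range element below `e`, hence
    -- in `I ⊆ P`.
    have hle : h a ⊓ dneg (h c) ≤ e :=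
      calc h a ⊓ dneg (h c) ≤ (e ⊔ h c) ⊓ dneg (h c) := inf_le_inf_right _ (h3.trans g3)
        _ = e ⊓ dneg (h c) := by rw [inf_sup_right, g1, sup_bot_eq]
        _ ≤ e := inf_le_left
    have hmem : h a ⊓ dneg (h c) ∈ P := hIP ⟨a ⊓ dneg c, by
      rw [h.map_inf, h.map_dneg]; exact h1.inf (g1.dneg hdm), by
      rw [h.map_inf, h.map_dneg], by rwa [h.map_inf, h.map_dneg]⟩
    exact (hP.mem_or_mem hmem).resolve_right (g1.dneg_notMem hdm hP g2)
  obtain ⟨Q, hQ, hJQ, hFQ⟩ := DistribLattice.prime_ideal_of_disjoint_filter_ideal hd'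
  refine ⟨P, Q, hP, hQ, heP, hJQ ⟨⊥, by rw [h.map_bot]; exact bot_c,
    by rw [h.map_bot]; exact P.bot_mem, le_sup_left⟩, fun a ha => ⟨fun h1 => ?_, fun h1 => ?_⟩⟩
  · exact hJQ ⟨a, ha, h1, le_sup_right⟩
  · by_contra h2
    exact Set.disjoint_left.1 hFQ ⟨a, ha, h2, le_rfl⟩ h1

/-- A homomorphism that meets every class of `d`, and for which `d` refines `c` on the range,
induces a homomorphism to the quotient by `c`. -/
noncomputable def transferHom (h : Hom A B) (c d : Congruence B) (hd : ∀ b, ∃ a, d.r b (h a))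
    (hcd : ∀ a a', d.r (h a) (h a') → c.r (h a) (h a')) : Hom B c.Quotient :=
  -- The value does not depend on the chosen representative.
  have key : ∀ b a, d.r b (h a) → c.toQuot (h (hd b).choose) = c.toQuot (h a) := fun b a hb =>
    c.toQuot_eq_iff.2 (hcd _ _ (d.iseqv.trans (d.iseqv.symm (hd b).choose_spec) hb))
  { toFun := fun b => c.toQuot (h (hd b).choose)
    map_sup' := fun x y => (key _ ((hd x).choose ⊔ (hd y).choose) (by
      rw [h.map_sup]; exact d.sup' (hd x).choose_spec (hd y).choose_spec)).trans (by
      rw [h.map_sup]; rfl)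
    map_inf' := fun x y => (key _ ((hd x).choose ⊓ (hd y).choose) (by
      rw [h.map_inf]; exact d.inf' (hd x).choose_spec (hd y).choose_spec)).trans (by
      rw [h.map_inf]; rfl)
    map_top' := (key _ ⊤ (by rw [h.map_top])).trans (by rw [h.map_top]; rfl)
    map_bot' := (key _ ⊥ (by rw [h.map_bot])).trans (by rw [h.map_bot]; rfl)
    map_himp' := fun x y => (key _ ((hd x).choose ⇨ (hd y).choose) (by
      rw [h.map_himp]; exact d.himp' (hd x).choose_spec (hd y).choose_spec)).trans (by
      rw [h.map_himp]; rfl)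
    map_dneg' := fun x => (key _ (dneg (hd x).choose) (by
      rw [h.map_dneg]; exact d.dneg' (hd x).choose_spec)).trans (by
      rw [h.map_dneg]; rfl) }

theorem transferHom_apply (h : Hom A B) (c d : Congruence B) (hd : ∀ b, ∃ a, d.r b (h a))
    (hcd : ∀ a a', d.r (h a) (h a') → c.r (h a) (h a')) {b : B} {a : A} (hb : d.r b (h a)) :
    transferHom h c d hd hcd b = c.toQuot (h a) :=
  c.toQuot_eq_iff.2 (hcd _ _ (d.iseqv.trans (d.iseqv.symm (hd b).choose_spec) hb))

end Epimorphism

end DHMSemiHeytingAlgebra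

open DHMSemiHeytingAlgebra in
theorem corollary4p21 (V : DHMSemiHeytingAlgebra.AlgClass.{u})
    (hV : DHMSemiHeytingAlgebra.IsSubvariety V DHMSemiHeytingAlgebra.RUNO1) :
    DHMSemiHeytingAlgebra.HasES V := by
  intro A B _ _ _ hVB h hepi
  have hB := hV.2 B hVB
  have hdm := hB.1.2
  have hl := hB.2.2.2
  have hVQ : ∀ (P : Order.Ideal B) (hP : P.IsPrime), V (primeCongruence P hP).Quotient :=
    fun P hP => hV.1.homImage _ _ (primeCongruence P hP).mkHom hVB (Congruence.toQuot_surjective _)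
  have hQ := fun P hP => hV.2 _ (hVQ P hP)
  refine surjective_of_central_subset_range hB hQ h fun e he => ?_
  by_contra hne
  obtain ⟨P, Q, hP, hQ', heP, heQ, htr⟩ := exists_prime_pair hdm h hne
  have hcd : ∀ a a', (primeCongruence Q hQ').r (h a) (h a') →
      (primeCongruence P hP).r (h a) (h a') := fun a a' haa => by
    rw [primeCongruence_iff hl, ← h.map_agree] at haa ⊢
    rwa [htr _ (by rw [h.map_agree]; exact isCentral_delta hl _)]
  have hd := exists_primeCongruence_constant hB hQ h Q hQ'
  have heq := hepi _ (hVQ P hP) (primeCongruence P hP).mkHom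
    (transferHom h _ (primeCongruence Q hQ') hd hcd) fun a =>
      (transferHom_apply h _ _ hd hcd ((primeCongruence Q hQ').iseqv.refl _)).symm
  -- The projection sends `e` to `⊤` as `e ∉ P`; the rival sends it to `⊥` as `e ∈ Q`.
  have h1 : (primeCongruence P hP).toQuot e = (primeCongruence P hP).toQuot ⊤ :=
    (Congruence.toQuot_eq_iff _).2 ⟨e, he, heP, by simp⟩
  have h2 : transferHom h (primeCongruence P hP) (primeCongruence Q hQ') hd hcd e =
      (primeCongruence P hP).toQuot (h ⊥) :=
    transferHom_apply h _ _ hd hcd ⟨dneg e, he.dneg hdm, he.dneg_notMem hdm hQ' heQ, by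
      rw [he, h.map_bot, bot_inf_eq]⟩
  rw [← heq, h.map_bot] at h2
  obtain ⟨f, -, hf, hf'⟩ := (Congruence.toQuot_eq_iff _).1 (h1.symm.trans h2)
  rw [top_inf_eq, bot_inf_eq] at hf'
  exact hf (hf' ▸ P.bot_mem)
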